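/- A multigraph here is unweighted, undirected and without self-loops, with parallel edges allowed. For a multigraph $G$ on the vertex set $V=\{1,\dots,n\}$ and $S\subseteq V$, let $w_G(S,\bar S)$ be the number of edges, counted with multiplicity, between $S$ and $\bar S=V\setminus S$, and let $\mathrm{Vol}_G(S)=\sum_{v\in S}\deg_G(v)$. A $(\delta,\epsilon)$-cut sketch of $G$ is a function $\mathsf{sk}:2^V\to\mathbb{R}_{\ge 0}$ such that for every $S\subseteq V$ $$(1-\delta)\,w_G(S,\bar S)-\epsilon\,\mathrm{Vol}_G(S)\ \le\ \mathsf{sk}(S)\ \le\ (1+\delta)\,w_G(S,\bar S)+\epsilon\,\mathrm{Vol}_G(S).$$ A $(\delta,\epsilon)$-cut sketching scheme for multigraphs with $n$ vertices and at most $n^2$ edges assigns to each such multigraph on $\{1,\dots,n\}$ a finite bit string, and to each bit string a function $2^V\to\mathbb{R}_{\ge 0}$, so that the function assigned to the bit string of $G$ is always a $(\delta,\epsilon)$-cut sketch of $G$. Theorem. There is an absolute constant $c>0$ with the following property. Let $\eta>0$, let $n\ge 1$ be an integer and let $\delta,\epsilon\in(0,\frac14)$ with $\max\{\epsilon,\delta\}\ge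 n^{-1/2+\eta}$. Then every $(\delta,\epsilon)$-cut sketching scheme for multigraphs with $n$ vertices and at most $n^2$ edges assigns to some multigraph a bit string of length at least $$c\,\eta\cdot\frac{n\log_2 n}{\max\{\epsilon^2,\delta^2\}}.$$ In particular (take $\eta=\frac14$), with an absolute implied constant, any $(\delta,\epsilon)$-cut sketching scheme needs $\Omega\left(\frac{n\log n}{\max\{\epsilon^2,\delta^2\}}\right)$ bits in the worst case whenever $n\ge\max\{\epsilon,\delta\}^{-4}$, hence for any fixed $\epsilon,\delta\in(0,\frac14)$ and all sufficiently large $n$. -/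

import Mathlib

open scoped NNReal

/-- An unweighted, undirected multigraph without self-loops on the vertex set `V`:
a multiset of unordered pairs of distinct vertices. -/
structure CutMultigraph (V : Type*) where
  /-- the edges, with multiplicity -/
  edges : Multiset (Sym2 V)
  /-- no edge is a self-loop -/
  loopless : ∀ e ∈ edges, ¬ e.IsDiag

namespace CutMultigraph

variable {V : Type*} [Fintype V] [DecidableEq V]

/-- `deg_G(v)`: the number of edges incident to `v`, with multiplicity. -/
def degree (G : CutMultigraph V) (v : V) : ℕ :=
  G.edges.countP (fun e => v ∈ e)

/-- `Vol_G(S) = ∑_{v ∈ S} deg_G(v)`. -/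
def vol (G : CutMultigraph V) (S : Finset V) : ℕ :=
  ∑ v ∈ S, G.degree v

/-- `w_G(S, V ∖ S)`: the number of edges, with multiplicity, that have one endpoint in `S` and
the other one outside of `S`. -/
def cutSize (G : CutMultigraph V) (S : Finset V) : ℕ :=
  G.edges.countP (fun e => ∃ u ∈ S, ∃ v ∈ Sᶜ, e = s(u, v))

/-- The function `sk` on the subsets of `V` is a `(δ, ε)`-cut sketch of `G`. -/
def IsCutSketch (δ ε : ℝ) (G : CutMultigraph V) (sk : Finset V → ℝ≥0) : Prop :=
  ∀ S : Finset V,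
    (1 - δ) * (G.cutSize S : ℝ) - ε * (G.vol S : ℝ) ≤ (sk S : ℝ) ∧
      (sk S : ℝ) ≤ (1 + δ) * (G.cutSize S : ℝ) + ε * (G.vol S : ℝ)

end CutMultigraph

/-- A `(δ, ε)`-cut sketching scheme for the multigraphs on `n` labelled vertices with at most `n²`
edges. Every such graph is stored as a finite string of bits, and the string alone determines a
`(δ, ε)`-cut sketch of the graph. Both maps are arbitrary functions. -/
structure CutSketchingScheme (δ ε : ℝ) (n : ℕ) where
  /-- the bit string stored for a graph -/
  encode : {G : CutMultigraph (Fin n) // G.edges.card ≤ n ^ 2} → List Bool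
  /-- the cut sketch that a bit string describes -/
  decode : List Bool → Finset (Fin n) → ℝ≥0
  /-- the decoded function is a `(δ, ε)`-cut sketch of the graph -/
  correct : ∀ G : {G : CutMultigraph (Fin n) // G.edges.card ≤ n ^ 2},
    G.1.IsCutSketch δ ε (decode (encode G))

/-!
Only the number of different code words matters: a scheme that takes `M` values on some family of
graphs uses `log₂ M - 1` bits on one of them (`exists_encode_length_ge`). Put `e = max ε δ`.

For small `e` the family consists of bipartite graphs with `m = n / 2` left-hand vertices. The
right-hand side is cut into `d ≈ 1 / (1600 e²)` blocks of `q ≈ n / 2d` vertices, and every left-hand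
vertex has one neighbour in each block, so the graphs are the functions
`f : Fin m × Fin d → Fin q` (`blockGraph`). If the graphs of `f` and `g` share a sketch, then every
cut has almost the same size in both, up to `O(e m d)`. On the other hand, give random signs to the
right-hand vertices, and let each left-hand vertex choose the sign that is best for it. A
left-hand vertex at which `f` and `g` differ in `a` blocks sees a random signed sum of `2a` terms,
of mean absolute value at least a multiple of `√a`, hence of `a / √d`: the latter is what
`khintchine_linear` gives and what can be summed over the left-hand side. So some cut
distinguishes the two graphs by a multiple of `hammingDist f g / √d`. As `1 / √d` is a large multiple
of `e`, the functions `f` and `g` agree at half of their places (`two_mul_hammingDist_le`). At most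
`(2 √q) ^ (m d)` functions do so with a given `f` (`card_mul_sqrt_pow_le`), which leaves at least
`q ^ (m d / 4)` code words. The assumption on `e` says that `n e² ≥ n ^ (2η)`, hence
`q ≥ n ^ (2η)`, and `m d log q / 4` is of the order of `η n log n / e²`.

For `e > 1 / 40` the number `d` of blocks would vanish, but then `1 / e²` is bounded, and `n log n`
bits are forced by perfect matchings. Two different matchings never share a sketch, because an edge
of the one that is missing from the other is a set of two vertices whose cut is empty in the one
graph and all of the volume in the other (`eq_of_common_sketch`).
-/

/-! ### Graphs given by a family of edges -/

namespace CutMultigraph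

variable {V : Type*}

/-- The multigraph with one edge `u i — v i` for each index `i`. -/
def ofEndpoints {I : Type*} [Fintype I] (u v : I → V) (h : ∀ i, u i ≠ v i) : CutMultigraph V where
  edges := (Finset.univ : Finset I).val.map fun i => s(u i, v i)
  loopless := by
    intro e he
    obtain ⟨i, -, rfl⟩ := Multiset.mem_map.1 he
    simpa using h i

variable {I : Type*} [Fintype I] (u v : I → V) (h : ∀ i, u i ≠ v i)

theorem card_edges_ofEndpoints : (ofEndpoints u v h).edges.card = Fintype.card I := by
  simp [ofEndpoints]

variable [DecidableEq V]

theorem vol_ofEndpoints (S : Finset V) :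
    (ofEndpoints u v h).vol S
      = ∑ i, ((if u i ∈ S then 1 else 0) + if v i ∈ S then 1 else 0) := by
  classical
  have hdeg : ∀ w, (ofEndpoints u v h).degree w
      = ∑ i, ((if u i = w then 1 else 0) + if v i = w then 1 else 0) := by
    intro w
    unfold degree ofEndpoints
    rw [Multiset.countP_map, ← Finset.filter_val, Finset.card_val, Finset.card_filter]
    refine Finset.sum_congr rfl fun i _ => ?_
    have := h i
    by_cases h1 : u i = w <;> by_cases h2 : v i = w
    · exact absurd (h1.trans h2.symm) this
    all_goals simp [h1, h2, eq_comm]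
    all_goals grind
  unfold vol
  simp only [hdeg]
  rw [Finset.sum_comm]
  exact Finset.sum_congr rfl fun i _ => by simp [Finset.sum_add_distrib]

theorem vol_ofEndpoints_le (S : Finset V) :
    (ofEndpoints u v h).vol S ≤ 2 * Fintype.card I := by
  rw [vol_ofEndpoints, Fintype.card_eq_sum_ones, Finset.mul_sum]
  exact Finset.sum_le_sum fun i _ => by split_ifs <;> simp

variable [Fintype V]

theorem cutSize_ofEndpoints (S : Finset V) :
    (ofEndpoints u v h).cutSize S
      = ∑ i, if (u i ∈ S ↔ v i ∈ S) then 0 else 1 := by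
  classical
  have key : ∀ i, (∃ a ∈ S, ∃ b ∈ Sᶜ, s(u i, v i) = s(a, b)) ↔ ¬ (u i ∈ S ↔ v i ∈ S) := by
    intro i
    constructor
    · rintro ⟨a, ha, b, hb, hab⟩
      rw [Finset.mem_compl] at hb
      rcases Sym2.eq_iff.1 hab with ⟨h1, h2⟩ | ⟨h1, h2⟩ <;> rw [h1, h2] <;> tauto
    · intro hne
      by_cases hu : u i ∈ S
      · exact ⟨u i, hu, v i, by simpa using fun hv => hne (iff_of_true hu hv), rfl⟩
      · have hv : v i ∈ S := by tauto
        exact ⟨v i, hv, u i, by simpa using hu, Sym2.eq_swap⟩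
  unfold cutSize ofEndpoints
  rw [Multiset.countP_map]
  simp only [key]
  rw [← Finset.filter_val, Finset.card_val, Finset.card_filter]
  exact Finset.sum_congr rfl fun i _ => by split_ifs <;> simp_all

theorem cutSize_ofEndpoints_le (S : Finset V) :
    (ofEndpoints u v h).cutSize S ≤ Fintype.card I := by
  rw [cutSize_ofEndpoints, Fintype.card_eq_sum_ones]
  exact Finset.sum_le_sum fun i _ => by split_ifs <;> simp

/-- The quadratic form of a graph on a vector of signs measures the cut that the signs define. -/
theorem sum_sign_mul_sign (S : Finset V) (z : V → ℝ) (hz : ∀ w, z w = if w ∈ S then 1 else -1) :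
    ∑ i, z (u i) * z (v i) = Fintype.card I - 2 * ((ofEndpoints u v h).cutSize S : ℝ) := by
  rw [cutSize_ofEndpoints, Fintype.card_eq_sum_ones]
  push_cast
  rw [Finset.mul_sum, ← Finset.sum_sub_distrib]
  refine Finset.sum_congr rfl fun i _ => ?_
  rw [hz, hz]
  by_cases h1 : u i ∈ S <;> by_cases h2 : v i ∈ S <;> simp [h1, h2] <;> norm_num

/-- Two graphs with `|I|` edges that have a common sketch agree on all cuts up to an error
proportional to `|I|`. -/
theorem abs_cutSize_sub_le {δ ε e : ℝ} (hδ : 0 ≤ δ) (hε : 0 ≤ ε) (hδe : δ ≤ e) (hεe : ε ≤ e)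
    {u' v' : I → V} (h' : ∀ i, u' i ≠ v' i) {sk : Finset V → ℝ≥0}
    (hG : (ofEndpoints u v h).IsCutSketch δ ε sk) (hH : (ofEndpoints u' v' h').IsCutSketch δ ε sk)
    (S : Finset V) :
    |((ofEndpoints u v h).cutSize S : ℝ) - (ofEndpoints u' v' h').cutSize S|
      ≤ 6 * e * Fintype.card I := by
  obtain ⟨g1, g2⟩ := hG S
  obtain ⟨h1, h2⟩ := hH S
  have c1 : ((ofEndpoints u v h).cutSize S : ℝ) ≤ Fintype.card I := by
    exact_mod_cast cutSize_ofEndpoints_le u v h S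
  have c2 : ((ofEndpoints u' v' h').cutSize S : ℝ) ≤ Fintype.card I := by
    exact_mod_cast cutSize_ofEndpoints_le u' v' h' S
  have v1 : ((ofEndpoints u v h).vol S : ℝ) ≤ 2 * Fintype.card I := by
    exact_mod_cast vol_ofEndpoints_le u v h S
  have v2 : ((ofEndpoints u' v' h').vol S : ℝ) ≤ 2 * Fintype.card I := by
    exact_mod_cast vol_ofEndpoints_le u' v' h' S
  have hI : (0 : ℝ) ≤ Fintype.card I := Nat.cast_nonneg _
  have := mul_le_mul_of_nonneg_left c1 hδ
  have := mul_le_mul_of_nonneg_left c2 hδ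
  have := mul_le_mul_of_nonneg_left v1 hε
  have := mul_le_mul_of_nonneg_left v2 hε
  have := mul_le_mul_of_nonneg_right hδe hI
  have := mul_le_mul_of_nonneg_right hεe hI
  rw [abs_le]
  constructor <;> linarith

end CutMultigraph

/-! ### Moments of random signed sums -/

theorem sign_sq (a : ℤˣ) : ((a : ℤ) : ℝ) ^ 2 = 1 := by
  rcases Int.units_eq_one_or a with h | h <;> simp [h]

section RandomSigns

variable {ι : Type*} [DecidableEq ι]

theorem sum_mul_sign_flip (a : ι → ℝ) {s : Finset ι} {j : ι} (hj : j ∉ s) (x : ι → ℤˣ) :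
    ∑ i ∈ s, a i * (((Pi.mulSingle j (-1) * x : ι → ℤˣ) i : ℤ) : ℝ)
      = ∑ i ∈ s, a i * ((x i : ℤ) : ℝ) := by
  refine Finset.sum_congr rfl fun i hi => ?_
  rw [Pi.mul_apply, Pi.mulSingle_eq_of_ne (ne_of_mem_of_not_mem hi hj), one_mul]

variable [Fintype ι]

/-- A sign is uncorrelated with every function that does not depend on it. -/
theorem sum_mul_sign_eq_zero (j : ι) (g : (ι → ℤˣ) → ℝ)
    (hg : ∀ x, g (Pi.mulSingle j (-1) * x) = g x) :
    ∑ x : ι → ℤˣ, g x * ((x j : ℤ) : ℝ) = 0 := by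
  have := Equiv.sum_comp (Equiv.mulLeft (Pi.mulSingle j (-1) : ι → ℤˣ))
    fun x => g x * ((x j : ℤ) : ℝ)
  simp only [Equiv.coe_mulLeft, hg, Pi.mul_apply, Pi.mulSingle_eq_same] at this
  simp only [neg_mul, one_mul, Units.val_neg, Int.cast_neg, mul_neg, Finset.sum_neg_distrib] at this
  linarith

theorem sum_signs_sq (a : ι → ℝ) (s : Finset ι) :
    ∑ x : ι → ℤˣ, (∑ i ∈ s, a i * ((x i : ℤ) : ℝ)) ^ 2
      = Fintype.card (ι → ℤˣ) * ∑ i ∈ s, a i ^ 2 := by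
  induction s using Finset.induction_on with
  | empty => simp
  | insert j s hj ih =>
    have hz := sum_mul_sign_eq_zero j (fun x => 2 * a j * ∑ i ∈ s, a i * ((x i : ℤ) : ℝ))
      (fun x => by rw [sum_mul_sign_flip a hj])
    have hexp : ∀ x : ι → ℤˣ, (∑ i ∈ insert j s, a i * ((x i : ℤ) : ℝ)) ^ 2
        = (∑ i ∈ s, a i * ((x i : ℤ) : ℝ)) ^ 2
          + (2 * a j * ∑ i ∈ s, a i * ((x i : ℤ) : ℝ)) * ((x j : ℤ) : ℝ) + a j ^ 2 := by
      intro x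
      rw [Finset.sum_insert hj]
      linear_combination a j ^ 2 * sign_sq (x j)
    simp only [hexp, Finset.sum_add_distrib, hz, ih, Finset.sum_const, Finset.card_univ,
      nsmul_eq_mul]
    rw [Finset.sum_insert hj]
    ring

theorem sum_signs_pow_four_le (a : ι → ℝ) (s : Finset ι) :
    ∑ x : ι → ℤˣ, (∑ i ∈ s, a i * ((x i : ℤ) : ℝ)) ^ 4
      ≤ 3 * Fintype.card (ι → ℤˣ) * (∑ i ∈ s, a i ^ 2) ^ 2 := by
  induction s using Finset.induction_on with
  | empty => simp
  | insert j s hj ih =>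
    have hz := sum_mul_sign_eq_zero j
      (fun x => 4 * a j * (∑ i ∈ s, a i * ((x i : ℤ) : ℝ)) ^ 3
        + 4 * a j ^ 3 * ∑ i ∈ s, a i * ((x i : ℤ) : ℝ))
      (fun x => by rw [sum_mul_sign_flip a hj])
    have hexp : ∀ x : ι → ℤˣ, (∑ i ∈ insert j s, a i * ((x i : ℤ) : ℝ)) ^ 4
        = (∑ i ∈ s, a i * ((x i : ℤ) : ℝ)) ^ 4
          + (4 * a j * (∑ i ∈ s, a i * ((x i : ℤ) : ℝ)) ^ 3
            + 4 * a j ^ 3 * ∑ i ∈ s, a i * ((x i : ℤ) : ℝ)) * ((x j : ℤ) : ℝ)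
          + 6 * a j ^ 2 * (∑ i ∈ s, a i * ((x i : ℤ) : ℝ)) ^ 2 + a j ^ 4 := by
      intro x
      rw [Finset.sum_insert hj]
      generalize (∑ i ∈ s, a i * ((x i : ℤ) : ℝ)) = X
      have h1 := sign_sq (x j)
      generalize ((x j : ℤ) : ℝ) = t at h1 ⊢
      linear_combination (6 * a j ^ 2 * X ^ 2 + 4 * a j ^ 3 * X * t + a j ^ 4 * (t ^ 2 + 1)) * h1
    rw [Finset.sum_congr rfl fun x _ => hexp x, Finset.sum_add_distrib, Finset.sum_add_distrib,
      Finset.sum_add_distrib, hz, ← Finset.mul_sum, sum_signs_sq, Finset.sum_const,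
      Finset.card_univ, nsmul_eq_mul, Finset.sum_insert hj]
    have : 0 ≤ (Fintype.card (ι → ℤˣ) : ℝ) * a j ^ 4 := by positivity
    nlinarith

/-- A Khintchine type inequality, in a form that is linear in `N = ∑ aᵢ²`: the mean of `|∑ ±aᵢ|`
is at least `3N / 4s` for every `s ≥ √(3N)`. -/
theorem khintchine_linear (a : ι → ℝ) {s : ℝ} (hs : 0 < s) (ha : 3 * ∑ i, a i ^ 2 ≤ s ^ 2) :
    3 * Fintype.card (ι → ℤˣ) * ∑ i, a i ^ 2
      ≤ 4 * s * ∑ x : ι → ℤˣ, |∑ i, a i * ((x i : ℤ) : ℝ)| := by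
  -- `4 s³ |t| ≥ 4 s² t² - t⁴`; summed over all signs, this reduces the claim to two moments.
  have hpt : ∀ t : ℝ, 4 * s ^ 2 * t ^ 2 - t ^ 4 ≤ 4 * s ^ 3 * |t| := by
    intro t
    rw [← sq_abs t, show t ^ 4 = |t| ^ 4 by rw [← abs_pow, abs_of_nonneg (by positivity)]]
    have h0 := abs_nonneg t
    generalize |t| = r at h0 ⊢
    -- The cubic in `r` is smallest at `r = 2s / √3`, which `7s / 6` approximates.
    have : 0 ≤ 4 * s ^ 3 - 4 * s ^ 2 * r + r ^ 3 := by
      nlinarith [mul_nonneg (add_nonneg h0 (by positivity : 0 ≤ 2 * s)) (sq_nonneg (r - 7 / 6 * s)),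
        mul_nonneg h0 (sq_nonneg s), pow_pos hs 3, sq_nonneg (r - 7 / 6 * s),
        mul_nonneg h0 (sq_nonneg (r - s))]
    nlinarith [mul_nonneg h0 this]
  have hsum := Finset.sum_le_sum fun (x : ι → ℤˣ) (_ : x ∈ Finset.univ) =>
    hpt (∑ i, a i * ((x i : ℤ) : ℝ))
  rw [Finset.sum_sub_distrib, ← Finset.mul_sum, ← Finset.mul_sum, sum_signs_sq] at hsum
  have h4 := sum_signs_pow_four_le a Finset.univ
  have hN : 0 ≤ ∑ i, a i ^ 2 := Finset.sum_nonneg fun i _ => sq_nonneg _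
  generalize (∑ i, a i ^ 2) = N at *
  generalize (∑ x : ι → ℤˣ, |∑ i, a i * ((x i : ℤ) : ℝ)|) = T at *
  have hC : (0 : ℝ) ≤ Fintype.card (ι → ℤˣ) := Nat.cast_nonneg _
  generalize (Fintype.card (ι → ℤˣ) : ℝ) = C at *
  have h5 : C * N * (3 * N) ≤ C * N * s ^ 2 :=
    mul_le_mul_of_nonneg_left ha (mul_nonneg hC hN)
  have h6 : s ^ 2 * (3 * C * N) ≤ s ^ 2 * (4 * s * T) := by nlinarith
  exact le_of_mul_le_mul_left h6 (by positivity)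

end RandomSigns

/-! ### Block graphs -/

open CutMultigraph

section BlockGraph

variable {V : Type*} [Fintype V] [DecidableEq V]
  {α κ γ : Type*} [Fintype α] [Fintype κ]

/-- The bipartite graph of `f : α × κ → γ`: the right-hand vertices `κ × γ` come in blocks indexed
by `κ`, and the left-hand vertex `a` is joined to the vertex `f (a, k)` of the block `k`, for
every `k`. The vertices of both sides are placed in `V` by `φ`. -/
def blockGraph (φ : α ⊕ κ × γ ↪ V) (f : α × κ → γ) : CutMultigraph V :=
  ofEndpoints (fun p : α × κ => φ (Sum.inl p.1)) (fun p => φ (Sum.inr (p.2, f p)))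
    fun _ h => by simpa using φ.injective h

variable [Fintype γ]

/-- If all cuts of two block graphs are close, then so are all signed sums over the right-hand
side: every left-hand vertex joins the side of the cut that is best for it. -/
theorem sum_abs_sub_le (φ : α ⊕ κ × γ ↪ V) (f g : α × κ → γ) {D : ℝ}
    (hD : ∀ S, |((blockGraph φ f).cutSize S : ℝ) - (blockGraph φ g).cutSize S| ≤ D)
    (x : κ × γ → ℤˣ) :
    ∑ a, |∑ k, (((x (k, f (a, k)) : ℤ) : ℝ) - ((x (k, g (a, k)) : ℤ) : ℝ))| ≤ 2 * D := by
  classical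
  set X : α → ℝ := fun a => ∑ k, (((x (k, f (a, k)) : ℤ) : ℝ) - ((x (k, g (a, k)) : ℤ) : ℝ)) with hX
  set S : Finset V := (Finset.univ.filter fun t : α ⊕ κ × γ =>
    Sum.elim (fun a => 0 ≤ X a) (fun b => x b = 1) t).map φ with hS
  set z : V → ℝ := fun w => if w ∈ S then 1 else -1 with hz
  have hmem : ∀ t, φ t ∈ S ↔ Sum.elim (fun a => 0 ≤ X a) (fun b => x b = 1) t := by
    intro t
    rw [hS, Finset.mem_map', Finset.mem_filter, and_iff_right (Finset.mem_univ t)]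
  have hl : ∀ a, z (φ (Sum.inl a)) = if 0 ≤ X a then 1 else -1 := by
    intro a; simp [hz, hmem]
  have hr : ∀ b, z (φ (Sum.inr b)) = ((x b : ℤ) : ℝ) := by
    intro b
    rcases Int.units_eq_one_or (x b) with h | h <;> simp [hz, hmem, h]
  have hf := sum_sign_mul_sign (fun p : α × κ => φ (Sum.inl p.1))
    (fun p => φ (Sum.inr (p.2, f p))) (fun _ h => by simpa using φ.injective h) S z fun _ => rfl
  have hg := sum_sign_mul_sign (fun p : α × κ => φ (Sum.inl p.1))
    (fun p => φ (Sum.inr (p.2, g p))) (fun _ h => by simpa using φ.injective h) S z fun _ => rfl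
  have hDS := (abs_le.1 (hD S)).1
  have hDS' := (abs_le.1 (hD S)).2
  unfold blockGraph at hDS hDS'
  have : ∑ a, |X a| = ∑ p : α × κ, z (φ (Sum.inl p.1)) * z (φ (Sum.inr (p.2, f p)))
      - ∑ p : α × κ, z (φ (Sum.inl p.1)) * z (φ (Sum.inr (p.2, g p))) := by
    rw [← Finset.sum_sub_distrib, Fintype.sum_prod_type]
    refine Finset.sum_congr rfl fun a _ => ?_
    simp only [hr, ← mul_sub, ← Finset.mul_sum]
    rw [hl]
    change |X a| = _ * X a
    split_ifs with h
    · rw [abs_of_nonneg h, one_mul]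
    · rw [abs_of_neg (not_le.1 h)]; ring
  rw [this, hf, hg]
  linarith

variable [DecidableEq κ] [DecidableEq γ]

/-- The functions of two block graphs with close cuts are close: for random signs on the right-hand
side, the sums bounded by `sum_abs_sub_le` have a mean proportional to the Hamming distance. The
parameter `s` is that of `khintchine_linear`; a row has at most `2|κ|` nonzero entries. -/
theorem three_mul_hammingDist_le (φ : α ⊕ κ × γ ↪ V) (f g : α × κ → γ) {D s : ℝ} (hs : 0 < s)
    (hκ : 6 * (Fintype.card κ : ℝ) ≤ s ^ 2)
    (hD : ∀ S, |((blockGraph φ f).cutSize S : ℝ) - (blockGraph φ g).cutSize S| ≤ D) :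
    3 * (hammingDist f g : ℝ) ≤ 4 * s * D := by
  -- `A a` is the row of `a` in the difference of the two biadjacency matrices.
  set A : α → κ × γ → ℝ := fun a b =>
    (if f (a, b.1) = b.2 then 1 else 0) - (if g (a, b.1) = b.2 then 1 else 0) with hA
  have hrow : ∀ a (x : κ × γ → ℤˣ), ∑ b, A a b * ((x b : ℤ) : ℝ)
      = ∑ k, (((x (k, f (a, k)) : ℤ) : ℝ) - ((x (k, g (a, k)) : ℤ) : ℝ)) := by
    intro a x
    rw [Fintype.sum_prod_type]
    refine Finset.sum_congr rfl fun k _ => ?_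
    simp [hA, sub_mul, Finset.sum_sub_distrib]
  have hsq : ∀ a, ∑ b, A a b ^ 2 = ∑ k, if f (a, k) ≠ g (a, k) then (2 : ℝ) else 0 := by
    intro a
    rw [Fintype.sum_prod_type]
    refine Finset.sum_congr rfl fun k _ => ?_
    have : ∀ c, A a (k, c) ^ 2 = (if f (a, k) = c then 1 else 0) + (if g (a, k) = c then 1 else 0)
        - 2 * (if f (a, k) = c then (if g (a, k) = c then 1 else 0) else 0) := by
      intro c
      simp only [hA]
      split_ifs <;> norm_num
    simp only [this, Finset.sum_sub_distrib, Finset.sum_add_distrib, ← Finset.mul_sum,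
      Finset.sum_ite_eq, Finset.mem_univ, if_true]
    by_cases h : f (a, k) = g (a, k)
    · simp [h]; norm_num
    · simp [h, Ne.symm h]; norm_num
  have hle : ∀ a, 3 * ∑ b, A a b ^ 2 ≤ s ^ 2 := by
    intro a
    rw [hsq]
    have : ∑ k, (if f (a, k) ≠ g (a, k) then (2 : ℝ) else 0) ≤ ∑ _k : κ, (2 : ℝ) :=
      Finset.sum_le_sum fun k _ => by split_ifs <;> norm_num
    simp only [Finset.sum_const, Finset.card_univ, nsmul_eq_mul] at this
    linarith
  have htot : ∑ a, ∑ b, A a b ^ 2 = 2 * (hammingDist f g : ℝ) := by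
    simp only [hsq]
    rw [← Fintype.sum_prod_type fun p : α × κ => if f p ≠ g p then (2 : ℝ) else 0, hammingDist,
      ← Finset.sum_filter, Finset.sum_const, nsmul_eq_mul, mul_comm]
  have h1 := Finset.sum_le_sum fun a (_ : a ∈ Finset.univ) => khintchine_linear (A a) hs (hle a)
  rw [← Finset.mul_sum, ← Finset.mul_sum, htot, Finset.sum_comm] at h1
  simp only [hrow] at h1
  have h2 := Finset.sum_le_sum fun x (_ : x ∈ (Finset.univ : Finset (κ × γ → ℤˣ))) =>
    sum_abs_sub_le φ f g hD x
  rw [Finset.sum_const, Finset.card_univ, nsmul_eq_mul] at h2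
  have hC : (0 : ℝ) < Fintype.card (κ × γ → ℤˣ) := by exact_mod_cast Fintype.card_pos
  have h3 := mul_le_mul_of_nonneg_left h2 (by positivity : 0 ≤ 4 * s)
  refine le_of_mul_le_mul_left ?_ hC
  linarith

/-- Block graphs with a common sketch come from functions that agree at half of the places or
more, provided that there are at most `1 / (1536 e²)` blocks. -/
theorem two_mul_hammingDist_le (φ : α ⊕ κ × γ ↪ V) (f g : α × κ → γ) {δ ε e : ℝ}
    (hδ : 0 ≤ δ) (hε : 0 ≤ ε) (he : 0 < e) (hδe : δ ≤ e) (hεe : ε ≤ e)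
    (hκ : 1536 * e ^ 2 * (Fintype.card κ : ℝ) ≤ 1) {sk : Finset V → ℝ≥0}
    (hf : (blockGraph φ f).IsCutSketch δ ε sk) (hg : (blockGraph φ g).IsCutSketch δ ε sk) :
    2 * hammingDist f g ≤ Fintype.card (α × κ) := by
  -- `s = 1 / (16 e)` turns the cut error `6 e N` into a Hamming distance of at most `N / 2`.
  have hs : (0 : ℝ) < 1 / (16 * e) := by positivity
  have := three_mul_hammingDist_le φ f g hs (D := 6 * e * Fintype.card (α × κ))
    (by rw [div_pow, le_div_iff₀ (by positivity)]; nlinarith)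
    (fun S => abs_cutSize_sub_le _ _ _ hδ hε hδe hεe _ hf hg S)
  have h2 : 4 * (1 / (16 * e)) * (6 * e * Fintype.card (α × κ))
      = 3 / 2 * (Fintype.card (α × κ) : ℝ) := by
    generalize (Fintype.card (α × κ) : ℝ) = N
    field_simp; ring
  rw [h2] at this
  have : 2 * (hammingDist f g : ℝ) ≤ Fintype.card (α × κ) := by linarith
  exact_mod_cast this

end BlockGraph

/-! ### Counting functions and code words -/

/-- The generating function of the number of agreements with a fixed function. -/
theorem sum_prod_agree {I γ : Type*} [Fintype I] [Fintype γ] [DecidableEq I] [DecidableEq γ]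
    (f : I → γ) (t : ℝ) :
    ∑ g : I → γ, ∏ i, (if f i = g i then t else 1)
      = (t + Fintype.card γ - 1) ^ Fintype.card I := by
  have h1 : ∀ c : γ, ∑ y, (if c = y then t else 1) = t + Fintype.card γ - 1 := by
    intro c
    have : ∀ y, (if c = y then t else 1) = (if c = y then t - 1 else 0) + 1 := by
      intro y; split_ifs <;> ring
    simp only [this, Finset.sum_add_distrib, Finset.sum_ite_eq, Finset.mem_univ, if_true,
      Finset.sum_const, Finset.card_univ, nsmul_eq_mul, mul_one]
    ring
  have h2 := Finset.prod_univ_sum (fun _ : I => (Finset.univ : Finset γ))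
    (fun i y => if f i = y then t else 1)
  rw [Fintype.piFinset_univ] at h2
  rw [← h2]
  simp only [h1, Finset.prod_const, Finset.card_univ]

/-- Hamming balls of half the length are small. The reason is the generating function
`∑ g, q ^ #{i | g i = f i} = (2q - 1) ^ N`. -/
theorem card_mul_sqrt_pow_le {I γ : Type*} [Fintype I] [Fintype γ] [DecidableEq I] [DecidableEq γ]
    [Nonempty γ] (f : I → γ) (B : Finset (I → γ))
    (hB : ∀ g ∈ B, 2 * hammingDist f g ≤ Fintype.card I) :
    (B.card : ℝ) * √(Fintype.card γ) ^ Fintype.card I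
      ≤ (2 * (Fintype.card γ : ℝ)) ^ Fintype.card I := by
  obtain ⟨q, hq⟩ : ∃ q : ℝ, q = Fintype.card γ := ⟨_, rfl⟩
  rw [← hq]
  have hq1 : 1 ≤ q := by rw [hq]; exact_mod_cast Fintype.card_pos
  have hq0 : 0 ≤ q := by linarith
  have hterm : ∀ g ∈ B, √q ^ Fintype.card I ≤ ∏ i, (if f i = g i then q else 1) := by
    intro g hg
    have hsplit := Finset.card_filter_add_card_filter_not (s := (Finset.univ : Finset I))
      (fun i => f i = g i)
    have hd : (Finset.univ.filter fun i => ¬ f i = g i).card = hammingDist f g := rfl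
    rw [Finset.card_univ, hd] at hsplit
    have := hB g hg
    rw [Finset.prod_ite, Finset.prod_const, Finset.prod_const_one, mul_one]
    calc √q ^ Fintype.card I
        ≤ √q ^ (2 * (Finset.univ.filter fun i => f i = g i).card) :=
          pow_le_pow_right₀ (Real.one_le_sqrt.2 hq1) (by omega)
      _ = _ := by rw [pow_mul, Real.sq_sqrt hq0]
  have hnonneg : ∀ g : I → γ, 0 ≤ ∏ i, (if f i = g i then q else 1) := fun g =>
    Finset.prod_nonneg fun i _ => by split_ifs <;> linarith
  calc (B.card : ℝ) * √q ^ Fintype.card I = ∑ _g ∈ B, √q ^ Fintype.card I := by simp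
    _ ≤ ∑ g ∈ B, ∏ i, (if f i = g i then q else 1) := Finset.sum_le_sum hterm
    _ ≤ ∑ g : I → γ, ∏ i, (if f i = g i then q else 1) :=
        Finset.sum_le_sum_of_subset_of_nonneg (Finset.subset_univ _) fun g _ _ => hnonneg g
    _ = (q + q - 1) ^ Fintype.card I := by rw [sum_prod_agree, ← hq]
    _ ≤ _ := pow_le_pow_left₀ (by linarith) (by linarith) _

/-- A map that identifies only functions that agree at half of the places or more has many
values. -/
theorem card_image_ge {I γ β : Type*} [Fintype I] [Fintype γ] [DecidableEq I] [DecidableEq γ]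
    [DecidableEq β] (hγ : 16 ≤ Fintype.card γ) (F : (I → γ) → β)
    (hF : ∀ f g, F f = F g → 2 * hammingDist f g ≤ Fintype.card I) :
    (Fintype.card I : ℝ) * Real.logb 2 (Fintype.card γ) / 4
      ≤ Real.logb 2 ((Finset.univ.image F).card) := by
  have : Nonempty γ := Fintype.card_pos_iff.1 (by omega)
  set q : ℝ := (Fintype.card γ : ℝ) with hq
  set N := Fintype.card I with hN
  have hq16 : (16 : ℝ) ≤ q := by rw [hq]; exact_mod_cast hγ
  have hqpos : 0 < q := by linarith
  have hsq : 0 < √q := Real.sqrt_pos.2 hqpos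
  set M : ℝ := ((Finset.univ.image F).card : ℝ) with hM
  have hMpos : 0 < M := by
    rw [hM]
    exact_mod_cast Finset.card_pos.2 (Finset.univ_nonempty.image F)
  have hcount : q ^ N * √q ^ N ≤ M * (2 * q) ^ N := by
    have h1 := Finset.card_eq_sum_card_image F Finset.univ
    rw [Finset.card_univ, Fintype.card_fun] at h1
    have h2 : q ^ N =
        ∑ b ∈ Finset.univ.image F, ((Finset.univ.filter fun f => F f = b).card : ℝ) := by
      rw [hq, hN]; exact_mod_cast h1
    rw [h2, Finset.sum_mul]
    refine (Finset.sum_le_card_nsmul _ _ ((2 * q) ^ N) ?_).trans_eq (by rw [nsmul_eq_mul])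
    intro b hb
    obtain ⟨f, -, rfl⟩ := Finset.mem_image.1 hb
    exact card_mul_sqrt_pow_le f _ fun g hg => hF f g (Finset.mem_filter.1 hg).2.symm
  have hlog := Real.logb_le_logb_of_le one_lt_two (by positivity) hcount
  have h2q : Real.logb 2 (2 * q) = 1 + Real.logb 2 q := by
    rw [Real.logb_mul (by norm_num) hqpos.ne', Real.logb_self_eq_one one_lt_two]
  have hsl : Real.logb 2 √q = Real.logb 2 q / 2 := by
    rw [Real.sqrt_eq_rpow, Real.logb_rpow_eq_mul_logb_of_pos hqpos]; ring
  rw [Real.logb_mul (by positivity) (by positivity), Real.logb_mul hMpos.ne' (by positivity),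
    Real.logb_pow, Real.logb_pow, Real.logb_pow, h2q, hsl] at hlog
  have h4 : 4 ≤ Real.logb 2 q := by
    rw [Real.le_logb_iff_rpow_le one_lt_two hqpos]
    norm_num; exact hq16
  have hN0 : (0 : ℝ) ≤ N := Nat.cast_nonneg _
  nlinarith [mul_le_mul_of_nonneg_left h4 hN0]

theorem card_le_two_pow_of_length_le (A : Finset (List Bool)) (L : ℕ)
    (hA : ∀ l ∈ A, l.length ≤ L) : A.card ≤ 2 ^ (L + 1) := by
  have hsub : A ⊆ (Finset.range (L + 1)).biUnion fun k =>
      (Finset.univ : Finset (List.Vector Bool k)).image List.Vector.toList := by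
    intro l hl
    rw [Finset.mem_biUnion]
    exact ⟨l.length, by simpa [Nat.lt_succ_iff] using hA l hl,
      Finset.mem_image.2 ⟨⟨l, rfl⟩, Finset.mem_univ _, rfl⟩⟩
  calc A.card ≤ _ := Finset.card_le_card hsub
    _ ≤ ∑ k ∈ Finset.range (L + 1), 2 ^ k := by
        refine Finset.card_biUnion_le.trans (Finset.sum_le_sum fun k _ => ?_)
        exact Finset.card_image_le.trans (by simp [card_vector])
    _ ≤ 2 ^ (L + 1) := by
        rw [Nat.geomSum_eq le_rfl]; simp

theorem logb_card_le (A : Finset (List Bool)) (hne : A.Nonempty) {T : ℝ}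
    (hA : ∀ l ∈ A, (l.length : ℝ) < T) : Real.logb 2 A.card ≤ T + 1 := by
  obtain ⟨l, hl⟩ := hne
  have hT : 0 ≤ T := (Nat.cast_nonneg _).trans (hA l hl).le
  have h1 := card_le_two_pow_of_length_le A ⌊T⌋₊ fun l hl => Nat.le_floor (hA l hl).le
  have hpos : (0 : ℝ) < A.card := by exact_mod_cast Finset.card_pos.2 ⟨l, hl⟩
  have h2 : (A.card : ℝ) ≤ 2 ^ (⌊T⌋₊ + 1) := by exact_mod_cast h1
  have h3 := Real.logb_le_logb_of_le one_lt_two hpos h2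
  rw [Real.logb_pow, Real.logb_self_eq_one one_lt_two] at h3
  push_cast at h3
  linarith [Nat.floor_le hT]

/-! ### Perfect matchings -/

section Matching

variable {V : Type*} [Fintype V] [DecidableEq V] {α : Type*} [Fintype α] [DecidableEq α]

/-- The perfect matching between two copies of `α` that the permutation `σ` describes. -/
def matchingGraph (φ : α ⊕ α ↪ V) (σ : Equiv.Perm α) : CutMultigraph V :=
  ofEndpoints (fun a => φ (Sum.inl a)) (fun a => φ (Sum.inr (σ a)))
    fun _ h => by simpa using φ.injective h

/-- Different matchings have no common sketch: an edge of the one that is missing from the other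
spans a set whose cut is empty in the one and all of the volume in the other. -/
theorem eq_of_common_sketch (φ : α ⊕ α ↪ V) (σ τ : Equiv.Perm α) {δ ε : ℝ}
    (hδ : δ < 1 / 4) (hε : ε < 1 / 4) {sk : Finset V → ℝ≥0}
    (hσ : (matchingGraph φ σ).IsCutSketch δ ε sk) (hτ : (matchingGraph φ τ).IsCutSketch δ ε sk) :
    σ = τ := by
  ext a
  by_contra hne
  set S : Finset V := {φ (Sum.inl a), φ (Sum.inr (σ a))} with hS
  have hl : ∀ b, φ (Sum.inl b) ∈ S ↔ b = a := by intro b; simp [hS]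
  have hr : ∀ b, φ (Sum.inr b) ∈ S ↔ b = σ a := by intro b; simp [hS]
  have hvol : ∀ ρ : Equiv.Perm α, (matchingGraph φ ρ).vol S = 2 := by
    intro ρ
    unfold matchingGraph
    rw [vol_ofEndpoints]
    simp only [hl, hr, ← Equiv.eq_symm_apply, Finset.sum_add_distrib, Finset.sum_ite_eq',
      Finset.mem_univ, if_true]
  have h0 : (matchingGraph φ σ).cutSize S = 0 := by
    unfold matchingGraph
    rw [cutSize_ofEndpoints]
    simp [hl, hr]
  have h2 : (matchingGraph φ τ).cutSize S = 2 := by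
    unfold matchingGraph
    rw [cutSize_ofEndpoints]
    have hne' : a ≠ τ.symm (σ a) := fun h => hne (by rw [Equiv.eq_symm_apply] at h; exact h.symm)
    have : ∀ b, (if (φ (Sum.inl b) ∈ S ↔ φ (Sum.inr (τ b)) ∈ S) then 0 else 1)
        = (if b = a then 1 else 0) + (if b = τ.symm (σ a) then 1 else 0) := by
      intro b
      simp only [hl, hr, ← Equiv.eq_symm_apply]
      by_cases h1 : b = a
      · subst h1; simp [hne']
      · by_cases h2 : b = τ.symm (σ a)
        · subst h2; simp [h1]
        · simp [h1, h2]
    simp only [this, Finset.sum_add_distrib, Finset.sum_ite_eq', Finset.mem_univ, if_true]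
  have u := (hσ S).2
  have l := (hτ S).1
  rw [hvol, h0] at u
  rw [hvol, h2] at l
  push_cast at u l
  linarith

end Matching

/-- A weak form of Stirling's formula, from `m ^ m / m! ≤ exp m`. -/
theorem half_mul_logb_le_logb_factorial {m : ℕ} (hm : 8 ≤ m) :
    (m : ℝ) * Real.logb 2 m / 2 ≤ Real.logb 2 (m.factorial) := by
  have hmpos : (0 : ℝ) < m := by exact_mod_cast (by omega : 0 < m)
  have hfac : (0 : ℝ) < m.factorial := by exact_mod_cast m.factorial_pos
  have h1 := Real.pow_div_factorial_le_exp (m : ℝ) hmpos.le m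
  rw [div_le_iff₀ hfac] at h1
  have h2 := Real.log_le_log (by positivity) h1
  rw [Real.log_mul (Real.exp_pos _).ne' hfac.ne', Real.log_exp, Real.log_pow] at h2
  have h3 : 2 ≤ Real.log m := by
    have : Real.log 8 ≤ Real.log m := Real.log_le_log (by norm_num) (by exact_mod_cast hm)
    have h8 : Real.log 8 = 3 * Real.log 2 := by
      rw [show (8 : ℝ) = 2 ^ 3 by norm_num, Real.log_pow]; norm_num
    linarith [Real.log_two_gt_d9]
  unfold Real.logb
  rw [mul_div_assoc', div_div, mul_comm (Real.log 2) 2, ← div_div]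
  have : 0 < Real.log 2 := Real.log_pos one_lt_two
  gcongr
  nlinarith

/-! ### Code lengths of sketching schemes -/

/-- A family of graphs among which the scheme takes `M` different values contains a graph with a
code of about `log₂ M` bits. -/
theorem exists_encode_length_ge {δ ε : ℝ} {n : ℕ} (sch : CutSketchingScheme δ ε n)
    {X : Type*} [Fintype X] [Nonempty X]
    (G : X → {G : CutMultigraph (Fin n) // G.edges.card ≤ n ^ 2}) {T : ℝ}
    (hT : T + 1 < Real.logb 2 (Finset.univ.image fun x => sch.encode (G x)).card) :
    ∃ H, T ≤ ((sch.encode H).length : ℝ) := by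
  by_contra! hlt
  refine (logb_card_le _ (Finset.univ_nonempty.image _) fun l hl => ?_).not_gt hT
  obtain ⟨x, -, rfl⟩ := Finset.mem_image.1 hl
  exact hlt _

/-- The bound from block graphs, with `m` left-hand vertices and `d` blocks of size `q`. -/
theorem exists_length_ge_of_blocks {δ ε e : ℝ} {n m d q : ℕ} (sch : CutSketchingScheme δ ε n)
    (hδ : 0 ≤ δ) (hε : 0 ≤ ε) (he : 0 < e) (hδe : δ ≤ e) (hεe : ε ≤ e)
    (hn : m + d * q ≤ n) (hmd : 8 ≤ m * d) (hq : 16 ≤ q) (hd : 1536 * e ^ 2 * d ≤ 1) {T : ℝ}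
    (hT : T ≤ m * d * Real.logb 2 q / 8) :
    ∃ H, T ≤ ((sch.encode H).length : ℝ) := by
  obtain ⟨φ⟩ : Nonempty (Fin m ⊕ Fin d × Fin q ↪ Fin n) :=
    Function.Embedding.nonempty_of_card_le (by simpa using hn)
  have hcard : ∀ f : Fin m × Fin d → Fin q, (blockGraph φ f).edges.card ≤ n ^ 2 := by
    intro f
    rw [blockGraph, card_edges_ofEndpoints]
    simp only [Fintype.card_prod, Fintype.card_fin]
    rw [sq]
    exact Nat.mul_le_mul (by omega) (by nlinarith)
  have : Nonempty (Fin q) := ⟨⟨0, by omega⟩⟩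
  refine exists_encode_length_ge sch (fun f : Fin m × Fin d → Fin q => ⟨_, hcard f⟩) ?_
  have key := card_image_ge (I := Fin m × Fin d) (γ := Fin q) (by simpa using hq)
    (fun f => sch.encode ⟨_, hcard f⟩) fun f g hfg => by
      have h1 := sch.correct ⟨_, hcard f⟩
      have h2 := sch.correct ⟨_, hcard g⟩
      rw [hfg] at h1
      exact two_mul_hammingDist_le φ f g hδ hε he hδe hεe (by simpa using hd) h1 h2
  simp only [Fintype.card_prod, Fintype.card_fin, Nat.cast_mul] at key
  refine lt_of_lt_of_le ?_ key
  have h4 : 4 ≤ Real.logb 2 q := by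
    rw [Real.le_logb_iff_rpow_le one_lt_two (by exact_mod_cast (by omega : 0 < q))]
    norm_num; exact_mod_cast hq
  have h8 : (8 : ℝ) ≤ m * d := by exact_mod_cast hmd
  nlinarith

theorem exists_length_ge_of_matchings {δ ε : ℝ} {n m : ℕ} (sch : CutSketchingScheme δ ε n)
    (hδ : δ < 1 / 4) (hε : ε < 1 / 4) (hn : 2 * m ≤ n) (hm : 8 ≤ m) {T : ℝ}
    (hT : T ≤ m * Real.logb 2 m / 4) :
    ∃ H, T ≤ ((sch.encode H).length : ℝ) := by
  obtain ⟨φ⟩ : Nonempty (Fin m ⊕ Fin m ↪ Fin n) :=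
    Function.Embedding.nonempty_of_card_le (by simp; omega)
  have hcard : ∀ σ : Equiv.Perm (Fin m), (matchingGraph φ σ).edges.card ≤ n ^ 2 := by
    intro σ
    rw [matchingGraph, card_edges_ofEndpoints, Fintype.card_fin]
    nlinarith
  refine exists_encode_length_ge sch (fun σ : Equiv.Perm (Fin m) => ⟨_, hcard σ⟩) ?_
  rw [Finset.card_image_of_injective, Finset.card_univ, Fintype.card_perm, Fintype.card_fin]
  · refine lt_of_lt_of_le ?_ (half_mul_logb_le_logb_factorial hm)
    have hm' : (8 : ℝ) ≤ m := by exact_mod_cast hm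
    have h3 : 3 ≤ Real.logb 2 m := by
      rw [Real.le_logb_iff_rpow_le one_lt_two (by linarith)]
      norm_num; exact hm
    nlinarith
  · intro σ τ hστ
    have h1 := sch.correct ⟨_, hcard σ⟩
    have h2 := sch.correct ⟨_, hcard τ⟩
    simp only at hστ
    rw [hστ] at h1
    exact eq_of_common_sketch φ σ τ hδ hε h1 h2

/-- The number of vertices is large in the range of parameters that the bound covers. -/
theorem sixteen_lt_of_rpow_lt {n : ℕ} {η : ℝ} (hn : 1 ≤ n) (hη : 0 ≤ η)
    (h : (n : ℝ) ^ (-(1 / 2 : ℝ) + η) < 1 / 4) : 16 < n := by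
  by_contra! hle
  have h1 : (1 : ℝ) ≤ n := by exact_mod_cast hn
  have h2 : (n : ℝ) ^ (-(1 / 2 : ℝ)) ≤ (n : ℝ) ^ (-(1 / 2 : ℝ) + η) :=
    Real.rpow_le_rpow_of_exponent_le h1 (by linarith)
  have h3 : (16 : ℝ) ^ (-(1 / 2 : ℝ)) ≤ (n : ℝ) ^ (-(1 / 2 : ℝ)) :=
    Real.rpow_le_rpow_of_nonpos (by linarith) (by exact_mod_cast hle) (by norm_num)
  have h4 : (16 : ℝ) ^ (-(1 / 2 : ℝ)) = 1 / 4 := by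
    rw [show (16 : ℝ) = 4 ^ (2 : ℝ) by norm_num, ← Real.rpow_mul (by norm_num),
      show (2 : ℝ) * -(1 / 2) = -1 by norm_num, Real.rpow_neg_one]
    norm_num
  linarith

theorem theorem5 :
    ∃ c : ℝ, 0 < c ∧
      ∀ (η : ℝ), 0 < η →
      ∀ (n : ℕ) (δ ε : ℝ), δ ∈ Set.Ioo (0 : ℝ) (1 / 4) → ε ∈ Set.Ioo (0 : ℝ) (1 / 4) →
        (n : ℝ) ^ (-(1 / 2 : ℝ) + η) ≤ max ε δ →
        ∀ sch : CutSketchingScheme δ ε n,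
          ∃ G : {G : CutMultigraph (Fin n) // G.edges.card ≤ n ^ 2},
            c * η * ((n : ℝ) * Real.logb 2 (n : ℝ) / max (ε ^ 2) (δ ^ 2))
              ≤ ((sch.encode G).length : ℝ) := by
  refine ⟨1 / 38400, by norm_num, ?_⟩
  intro η hη n δ ε hδ hε hmax sch
  rcases Nat.eq_zero_or_pos n with rfl | hn
  · exact ⟨⟨⟨0, by simp⟩, by simp⟩, by simp⟩
  have hsq : max (ε ^ 2) (δ ^ 2) = max ε δ ^ 2 := by
    rcases le_total ε δ with h | h
    · rw [max_eq_right h, max_eq_right (pow_le_pow_left₀ hε.1.le h 2)]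
    · rw [max_eq_left h, max_eq_left (pow_le_pow_left₀ hδ.1.le h 2)]
  rw [hsq]
  have he0 : 0 < max ε δ := lt_max_of_lt_left hε.1
  have he4 : max ε δ < 1 / 4 := max_lt hε.2 hδ.2
  have hεe : ε ≤ max ε δ := le_max_left _ _
  have hδe : δ ≤ max ε δ := le_max_right _ _
  generalize max ε δ = e at *
  have hn16 : 16 < n := sixteen_lt_of_rpow_lt hn hη.le (hmax.trans_lt he4)
  have hnR : (16 : ℝ) < n := by exact_mod_cast hn16
  have hn0 : (0 : ℝ) < n := by linarith
  have hlogn : 0 < Real.logb 2 n := Real.logb_pos one_lt_two (by linarith)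
  have hη2 : η < 1 / 2 := by
    by_contra! hge
    have := Real.one_le_rpow (by linarith : (1 : ℝ) ≤ n) (by linarith : 0 ≤ -(1 / 2 : ℝ) + η)
    linarith
  have hm3 : (n : ℝ) ≤ 3 * (n / 2 : ℕ) := by exact_mod_cast (by omega : n ≤ 3 * (n / 2))
  have hmpos : (0 : ℝ) < (n / 2 : ℕ) := by linarith
  rcases lt_or_ge (1 / 40) e with hbig | hsmall
  · -- Constant accuracy: the `(n / 2)!` perfect matchings already need `Ω(n log n)` bits.
    refine exists_length_ge_of_matchings sch hδ.2 hε.2 (m := n / 2) (by omega) (by omega) ?_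
    have hlogm : Real.logb 2 n ≤ 2 * Real.logb 2 (n / 2 : ℕ) := by
      rw [← Real.logb_rpow_eq_mul_logb_of_pos hmpos]
      exact Real.logb_le_logb_of_le one_lt_two hn0 (by rw [Real.rpow_two]; nlinarith)
    have hinv : (n : ℝ) * Real.logb 2 n / e ^ 2 ≤ 1600 * (n * Real.logb 2 n) := by
      rw [div_le_iff₀ (by positivity)]
      have : 1 ≤ 1600 * e ^ 2 := by nlinarith
      nlinarith [mul_pos hn0 hlogn]
    have h1 : 1 / 38400 * η * ((n : ℝ) * Real.logb 2 n / e ^ 2)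
        ≤ 1 / 38400 * (1 / 2) * (1600 * (n * Real.logb 2 n)) := by gcongr
    have h2 := mul_le_mul hm3 hlogm hlogn.le (by positivity)
    nlinarith [mul_pos hn0 hlogn]
  · -- High accuracy: block graphs with `d ≈ 1 / (1600 e²)` blocks of size `q ≥ n ^ (2η)`.
    set d : ℕ := ⌊1 / (1600 * e ^ 2)⌋₊ with hd
    have he2 : 0 < 1600 * e ^ 2 := by positivity
    have hone : 1 ≤ 1 / (1600 * e ^ 2) := by rw [le_div_iff₀ he2]; nlinarith
    have hd1 : 1 ≤ d := Nat.le_floor (by exact_mod_cast hone)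
    have hd1R : (1 : ℝ) ≤ d := by exact_mod_cast hd1
    have hdle : (d : ℝ) ≤ 1 / (1600 * e ^ 2) := Nat.floor_le (by positivity)
    have hdlt : 1 / (1600 * e ^ 2) < d + 1 := Nat.lt_floor_add_one _
    have hde : 1600 * e ^ 2 * d ≤ 1 := by
      rw [le_div_iff₀ he2] at hdle; linarith
    have hed : 1 ≤ 3200 * e ^ 2 * d := by
      rw [div_lt_iff₀ he2] at hdlt; nlinarith
    set q : ℕ := n / (2 * d) with hqdef
    have hqlt : (n : ℝ) < (q + 1) * (2 * d) := by
      have := Nat.lt_div_mul_add (a := n) (b := 2 * d) (by omega)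
      have : n < (q + 1) * (2 * d) := by rw [add_mul, one_mul]; exact this
      exact_mod_cast this
    -- `n e² ≥ n ^ (2η)` is the hypothesis on the accuracy.
    have hpow : (n : ℝ) ^ (2 * η) ≤ n * e ^ 2 := by
      have h1 : ((n : ℝ) ^ (-(1 / 2 : ℝ) + η)) ^ 2 ≤ e ^ 2 :=
        pow_le_pow_left₀ (by positivity) hmax 2
      rw [← Real.rpow_mul_natCast hn0.le] at h1
      calc (n : ℝ) ^ (2 * η) = n * (n : ℝ) ^ ((-(1 / 2 : ℝ) + η) * (2 : ℕ)) := by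
            nth_rw 2 [← Real.rpow_one (n : ℝ)]
            rw [← Real.rpow_add hn0]; congr 1; push_cast; ring
        _ ≤ n * e ^ 2 := by gcongr
    have hpow1 : 1 ≤ (n : ℝ) ^ (2 * η) := Real.one_le_rpow (by linarith) (by linarith)
    have hqbig : 800 * (n : ℝ) ^ (2 * η) < q + 1 := by
      have h1 : (n : ℝ) * (1600 * e ^ 2 * d) ≤ n * 1 := by gcongr
      have h2 : (d : ℝ) * (1600 * (n : ℝ) ^ (2 * η)) ≤ d * (1600 * (n * e ^ 2)) := by gcongr
      have h3 : (d : ℝ) * (800 * (n : ℝ) ^ (2 * η)) < d * (q + 1) := by linarith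
      exact lt_of_mul_lt_mul_left h3 (by linarith)
    have hq16 : 16 ≤ q := by
      have : (16 : ℝ) ≤ q := by linarith
      exact_mod_cast this
    have hlogq : 2 * η * Real.logb 2 n ≤ Real.logb 2 q := by
      rw [← Real.logb_rpow_eq_mul_logb_of_pos hn0]
      exact Real.logb_le_logb_of_le one_lt_two (by positivity) (by linarith)
    have hverts : n / 2 + d * q ≤ n := by
      have : q * (2 * d) ≤ n := Nat.div_mul_le_self _ _
      have : 2 * (d * q) ≤ n := by linarith
      omega
    refine exists_length_ge_of_blocks sch hδ.1.le hε.1.le he0 hδe hεe hverts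
      (Nat.mul_le_mul (by omega : 8 ≤ n / 2) hd1) hq16 (by nlinarith) ?_
    have hinv : 1 / e ^ 2 ≤ 3200 * d := by
      rw [div_le_iff₀ (by positivity)]; linarith
    calc 1 / 38400 * η * ((n : ℝ) * Real.logb 2 n / e ^ 2)
        = 1 / 38400 * (n * (1 / e ^ 2) * (η * Real.logb 2 n)) := by ring
      _ ≤ 1 / 38400 * (3 * (n / 2 : ℕ) * (3200 * d) * (Real.logb 2 q / 2)) := by
          gcongr
          linarith
      _ = _ := by ring
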